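/- Let $q$ be a prime power, let $\vartheta:\mathbb F_q^+\to\mathbb C^\times$ be a fixed nontrivial homomorphism, and let $K\subseteq L\subseteq\{1,\dots,n\}$. Let $U_L=U_L(q)$ be the group of unipotent upper-triangular $n\times n$ matrices $u$ over $\mathbb F_q$ with $u_{ij}=0$ for $i<j$ unless $i,j\in L$; define $U_K\subseteq U_L$ likewise. An arc $i\overset{a}{-}l$ of $L$ consists of $i<l$ in $L$ and a label $a\in\mathbb F_q^\times$. A $q$-set partition of $L$ is a finite set $\lambda$ of arcs of $L$ such that distinct arcs have distinct left endpoints and distinct right endpoints. The superclass of $U_L$ indexed by a $q$-set partition $\mu$ of $L$ is the set of $u\in U_L$ such that $x(u-1)y=\sum_{j\overset{b}{-}k\in\mu}b\,e_{jk}$ for some $x,y\in U_L$, where $e_{jk}$ are the matrix units; these superclasses partition $U_L$. The supercharacter of $U_L$ attached to $\lambda$ is $\chi^\lambda=\prod_{i\overset{a}{-}l\in\lambda}\chi^{i\overset{a}{-}l}$, where $\chi^{i\overset{a}{-}l}$ takes on the superclass indexed by $\mu$ the value $0$ if $\mu$ contains an arc $j\overset{b}{-}k$ with $i=j<k<l$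 or $i<j<k=l$, and otherwise the value $$\frac{q^{|\{j\in L\,:\,i<j<l\}|}}{q^{|\{j\overset{b}{-}k\in\mu\,:\,i<j<k<l\}|}}\;\vartheta\bigl(a\,\mathrm{wt}_{il}(\mu)\bigr),$$ where $\mathrm{wt}_{il}(\mu)$ is the sum of the labels of the arcs of $\mu$ from $i$ to $l$. Theorem 5.1. Let $\lambda$ be a $q$-set partition of $L$ such that every arc of $\lambda$ has exactly one endpoint in $K$. Then the multiplicity of the trivial character $1$ in the restriction of $\chi^\lambda$ to $U_K$ is $$\bigl\langle \mathrm{Res}^{U_L}_{U_K}(\chi^\lambda),1\bigr\rangle=q^{r_K^L(\lambda)}\,q^{|\mathcal C_K(\lambda)|},$$ where $\langle f,g\rangle=\frac1{|U_K|}\sum_{u\in U_K}f(u)\overline{g(u)}$, $r_K^L(\lambda)$ is the number of pairs consisting of a node $j\in L\setminus K$ and an arc $i\overset{a}{-}l\in\lambda$ with $i<j<l$, and $\mathcal C_K(\lambda)$ is the set of pairs $(i\overset{a}{-}k,\ j\overset{b}{-}l)$ of arcs of $\lambda$ with $i<j<k<l$, $i,l\notin K$ and $j,k\in K$. -/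

import Mathlib

/-- A labelled arc with nodes in `Fin n`: a left endpoint, a right endpoint and a label. -/
structure Arc (n : ℕ) (F : Type*) where
  left : Fin n
  right : Fin n
  label : F

/-- `lam` is a `q`-set partition of the set of nodes `K` (`q` the cardinality of `F`):
every arc goes from a smaller to a larger node of `K` and has a nonzero label, and two distinct
arcs have distinct left endpoints and distinct right endpoints. (In a multiset of arcs with
this property no arc is repeated, so finite sets of arcs suffice.) -/
def IsQSetPartition {n : ℕ} {F : Type*} [Field F] (K : Finset (Fin n))
    (lam : Finset (Arc n F)) : Prop :=
  (∀ α ∈ lam, α.left ∈ K ∧ α.right ∈ K ∧ α.left < α.right ∧ α.label ≠ 0) ∧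
    ∀ α ∈ lam, ∀ β ∈ lam, α ≠ β → α.left ≠ β.left ∧ α.right ≠ β.right

/-- The unipotent upper-triangular `n × n` matrices whose entries above the diagonal vanish
outside of the positions `(i, j)` with `i, j ∈ K`. -/
def IsUnipotentOn {n : ℕ} {F : Type*} [Field F] (K : Finset (Fin n))
    (u : Matrix (Fin n) (Fin n) F) : Prop :=
  (∀ i, u i i = 1) ∧ (∀ i j, j < i → u i j = 0) ∧
    ∀ i j, i < j → ¬ (i ∈ K ∧ j ∈ K) → u i j = 0

theorem IsUnipotentOn.one {n : ℕ} {F : Type*} [Field F] (K : Finset (Fin n)) :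
    IsUnipotentOn K (1 : Matrix (Fin n) (Fin n) F) :=
  ⟨fun i => Matrix.one_apply_eq i, fun _ _ h => Matrix.one_apply_ne h.ne',
    fun _ _ h _ => Matrix.one_apply_ne h.ne⟩

theorem IsUnipotentOn.mul {n : ℕ} {F : Type*} [Field F] {K : Finset (Fin n)}
    {u v : Matrix (Fin n) (Fin n) F} (hu : IsUnipotentOn K u) (hv : IsUnipotentOn K v) :
    IsUnipotentOn K (u * v) := by
  obtain ⟨hu1, hu2, hu3⟩ := hu
  obtain ⟨hv1, hv2, hv3⟩ := hv
  refine ⟨fun i => ?_, fun i j hij => ?_, fun i j hij hK => ?_⟩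
  · rw [Matrix.mul_apply, Finset.sum_eq_single i]
    · rw [hu1, hv1, one_mul]
    · intro k _ hk
      rcases lt_or_gt_of_ne hk with h | h
      · rw [hu2 i k h, zero_mul]
      · rw [hv2 k i h, mul_zero]
    · simp
  · rw [Matrix.mul_apply]
    refine Finset.sum_eq_zero fun k _ => ?_
    rcases lt_or_ge k i with h | h
    · rw [hu2 i k h, zero_mul]
    · rw [hv2 k j (lt_of_lt_of_le hij h), mul_zero]
  · rw [Matrix.mul_apply]
    refine Finset.sum_eq_zero fun k _ => ?_
    by_cases hi : i ∈ K
    · have hj : j ∉ K := fun hj => hK ⟨hi, hj⟩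
      rcases lt_trichotomy k j with h | h | h
      · rw [hv3 k j h (fun h' => hj h'.2), mul_zero]
      · rw [h, hu3 i j hij hK, zero_mul]
      · rw [hv2 k j h, mul_zero]
    · rcases lt_trichotomy i k with h | h | h
      · rw [hu3 i k h (fun h' => hi h'.1), zero_mul]
      · rw [← h, hv3 i j hij hK, mul_zero]
      · rw [hu2 i k h, zero_mul]

/-- The group `U_K(q)` of unipotent upper-triangular matrices supported on `K`, as a subgroup
of the general linear group. -/
def unipotentGroup {n : ℕ} (F : Type*) [Field F] [Finite F] (K : Finset (Fin n)) :
    Subgroup (GL (Fin n) F) where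
  carrier := {g | IsUnipotentOn K (g : Matrix (Fin n) (Fin n) F)}
  one_mem' := by
    simpa using IsUnipotentOn.one (F := F) K
  mul_mem' := by
    intro a b ha hb
    simpa using IsUnipotentOn.mul ha hb
  inv_mem' := by
    intro g hg
    have hpow : ∀ m : ℕ, IsUnipotentOn K ((g ^ m : GL (Fin n) F) : Matrix (Fin n) (Fin n) F) := by
      intro m
      induction m with
      | zero => simpa using IsUnipotentOn.one (F := F) K
      | succ m ih =>
        rw [pow_succ]
        simpa using IsUnipotentOn.mul ih hg
    have hinv : g⁻¹ = g ^ (orderOf g - 1) := by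
      rw [inv_eq_iff_mul_eq_one, ← pow_succ', Nat.sub_add_cancel (orderOf_pos g),
        pow_orderOf_eq_one]
    rw [hinv]
    exact hpow _

theorem unipotentGroup_mono {n : ℕ} (F : Type*) [Field F] [Finite F] {K L : Finset (Fin n)}
    (hKL : K ⊆ L) : unipotentGroup F K ≤ unipotentGroup F L :=
  fun _ hg => ⟨hg.1, hg.2.1, fun i j hij h => hg.2.2 i j hij fun h' => h ⟨hKL h'.1, hKL h'.2⟩⟩

/-- The superclass of `U_K(q)` indexed by `mu`: the elements `u` such that `u - 1` is in the
two-sided `U_K(q)`-orbit of the matrix with entry `b` at `(j, k)` for every arc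
`(j, k)` of `mu` with label `b`, and zeros elsewhere. -/
def superclass {n : ℕ} {F : Type*} [Field F] [Finite F] (K : Finset (Fin n))
    (mu : Finset (Arc n F)) : Set (unipotentGroup F K) :=
  {u | ∃ x y : unipotentGroup F K,
    ((x : GL (Fin n) F) : Matrix (Fin n) (Fin n) F) *
        (((u : GL (Fin n) F) : Matrix (Fin n) (Fin n) F) - 1) *
        ((y : GL (Fin n) F) : Matrix (Fin n) (Fin n) F) =
      ∑ β ∈ mu, Matrix.single β.left β.right β.label}

open Classical in
/-- The sum of the labels of the arcs from `i` to `l` in `mu`. -/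
noncomputable def arcWeight {n : ℕ} {F : Type*} [Field F] (mu : Finset (Arc n F))
    (i l : Fin n) : F :=
  ∑ β ∈ mu with β.left = i ∧ β.right = l, β.label

open Classical in
/-- The value of the supercharacter `χ^α` of `U_K(q)`, for a single arc `α` from `i` to `l`
with label `a`, on the superclass indexed by `mu`. -/
noncomputable def arcValue {n : ℕ} {F : Type*} [Field F] [Finite F] (θ : AddChar F ℂ)
    (K : Finset (Fin n)) (α : Arc n F) (mu : Finset (Arc n F)) : ℂ :=
  if ∃ β ∈ mu, (α.left = β.left ∧ β.left < β.right ∧ β.right < α.right) ∨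
      (α.left < β.left ∧ β.left < β.right ∧ β.right = α.right) then 0
  else
    (Nat.card F : ℂ) ^ (K.filter fun j => α.left < j ∧ j < α.right).card /
        (Nat.card F : ℂ) ^ (mu.filter fun β =>
          α.left < β.left ∧ β.left < β.right ∧ β.right < α.right).card *
      θ (α.label * arcWeight mu α.left α.right)

open Classical in
/-- The supercharacter `χ^α` of `U_K(q)` for a single arc `α`. Every element of `U_K(q)` lies
in the superclass indexed by exactly one `q`-set partition of `K`; the value at `u` is the value
on this superclass. -/
noncomputable def arcCharacter {n : ℕ} {F : Type*} [Field F] [Finite F] (θ : AddChar F ℂ)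
    (K : Finset (Fin n)) (α : Arc n F) (u : unipotentGroup F K) : ℂ :=
  if h : ∃ mu : Finset (Arc n F), IsQSetPartition K mu ∧ u ∈ superclass K mu then
    arcValue θ K α h.choose
  else 0

/-- The supercharacter `χ^lam` of `U_K(q)`: the product of the `χ^α` over the arcs `α`
of `lam`. -/
noncomputable def supercharacter {n : ℕ} {F : Type*} [Field F] [Finite F] (θ : AddChar F ℂ)
    (K : Finset (Fin n)) (lam : Finset (Arc n F)) (u : unipotentGroup F K) : ℂ :=
  ∏ α ∈ lam, arcCharacter θ K α u

/-- Restriction of functions from `U_L(q)` to `U_K(q)` for `K ⊆ L`. -/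
def resUnipotent {n : ℕ} {F : Type*} [Field F] [Finite F] {K L : Finset (Fin n)} (hKL : K ⊆ L)
    (f : unipotentGroup F L → ℂ) (u : unipotentGroup F K) : ℂ :=
  f (Subgroup.inclusion (unipotentGroup_mono F hKL) u)

/-- The usual inner product of complex functions on a finite group. -/
noncomputable def characterInner {G : Type*} [Group G] [Finite G] (f g : G → ℂ) : ℂ :=
  (Nat.card G : ℂ)⁻¹ * ∑ᶠ u : G, f u * (starRingEnd ℂ) (g u)

open Classical in
/-- The number `r_K^L(lam)` of pairs of a node `j ∈ L` outside of `K` and an arc of `lam` with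
`j` strictly between its endpoints. -/
noncomputable def rStat {n : ℕ} {F : Type*} (K L : Finset (Fin n)) (lam : Finset (Arc n F)) : ℕ :=
  ((L ×ˢ lam).filter fun p => p.2.left < p.1 ∧ p.1 < p.2.right ∧ p.1 ∉ K).card

open Classical in
/-- The set `C_K(lam)` of crossings of an arc `i-k` with an arc `j-l`, where `i < j < k < l`
with `i, l ∉ K` and `j, k ∈ K`. -/
noncomputable def crossings {n : ℕ} {F : Type*} (K : Finset (Fin n)) (lam : Finset (Arc n F)) :
    Finset (Arc n F × Arc n F) :=
  (lam ×ˢ lam).filter fun p =>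
    (p.1.left < p.2.left ∧ p.2.left < p.1.right ∧ p.1.right < p.2.right) ∧
      p.1.left ∉ K ∧ p.2.right ∉ K ∧ p.2.left ∈ K ∧ p.1.right ∈ K

open Finset
open scoped BigOperators Classical

/-! ### Averages of products and of additive characters -/

section Expectation

/-! For one arc from `i` to `l` with label `a`, the value of its supercharacter at `u = 1 + N` is `q
^ |between|` times the average of `θ (a * (x N y))`. Here the row vector `x` has entry `1` at `i`,
the column vector `y` has entry `1` at `l`, and both are free on the nodes of `L` strictly between
(`arcCharacter_eq`). This average is invariant under `N ↦ g N h` with `g, h ∈ U_L`. On a matrix of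
arcs it factors over the arcs and gives `arcValue`, and elimination brings every `N` to such a form.

On `U_K` exactly one endpoint of each arc lies in `K`. Averaging out the vector based at the other
endpoint leaves the indicator of a homogeneous linear system in `N`: `(N y)_j = 0` if the right
endpoint is in `K`, `(x N)_j = 0` if the left one is, for the nodes `j ∈ K` under the arc. The phase
is `1`, since it is an entry of `N y` or `x N` outside `K`. So the multiplicity is `q ^ (r + number
of conditions)` times the probability that a random `N` satisfies the system, averaged over the
remaining vectors, one per arc.

For any choice of these vectors the condition at `(α, j)` has a leading entry of `N`, the one
farthest from the diagonal: `(j, α.right)` for a column condition, `(α.left, j)` for a row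
condition. Two leading entries coincide exactly at the crossings in `C_K`. There the column
condition follows from the other conditions, by computing `x N y` in two ways
(`arcForm_eq_zero_of_notMem_redundantNodes`). After these are dropped the system is triangular, so
the probability is `q ^ (|C_K| - number of conditions)` (`expect_prod_arcForm`). -/

theorem expect_pi_prod {ι X : Type*} [Fintype ι] [DecidableEq ι] [Fintype X] [Nonempty X]
    (G : ι → X → ℂ) : 𝔼 x : ι → X, ∏ i, G i (x i) = ∏ i, 𝔼 t, G i t := by
  simp only [Fintype.expect_eq_sum_div_card, prod_div_distrib, Finset.prod_univ_sum,
    Fintype.piFinset_univ, prod_const, Finset.card_univ, Fintype.card_fun, Nat.cast_pow]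

/-- Injectivity makes the factors depend on distinct coordinates, so they are independent; each
fibre of `f` holds at most one factor. -/
theorem expect_pi_prod_of_injOn {ι κ X : Type*} [Fintype ι] [DecidableEq ι] [Fintype X] [Nonempty X]
    (s : Finset κ) (f : κ → ι) (hf : Set.InjOn f s) (G : κ → X → ℂ) :
    𝔼 x : ι → X, ∏ c ∈ s, G c (x (f c)) = ∏ c ∈ s, 𝔼 t, G c t := by
  have h : ∀ x : ι → X, ∏ c ∈ s, G c (x (f c)) = ∏ i, ∏ c ∈ s with f c = i, G c (x i) := by
    intro x
    rw [← Finset.prod_fiberwise s f]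
    refine Finset.prod_congr rfl fun i _ => Finset.prod_congr rfl fun c hc => ?_
    rw [(Finset.mem_filter.1 hc).2]
  simp only [h]
  rw [expect_pi_prod (fun i t => ∏ c ∈ s with f c = i, G c t),
    ← Finset.prod_fiberwise s f]
  refine Finset.prod_congr rfl fun i _ => ?_
  by_cases hi : ∃ c ∈ s, f c = i
  · obtain ⟨c, hc, rfl⟩ := hi
    have : (s.filter fun d => f d = f c) = {c} := by
      ext d
      simp only [Finset.mem_filter, Finset.mem_singleton]
      exact ⟨fun hd => hf hd.1 hc hd.2, by rintro rfl; exact ⟨hc, rfl⟩⟩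
    simp [this]
  · have : (s.filter fun d => f d = i) = ∅ := by
      ext d
      simp only [Finset.mem_filter, Finset.notMem_empty, iff_false]
      exact fun hd => hi ⟨d, hd⟩
    simp [this]

theorem addChar_sum_eq_prod {F κ : Type*} [Field F] (θ : AddChar F ℂ) (s : Finset κ)
    (f : κ → F) : θ (∑ c ∈ s, f c) = ∏ c ∈ s, θ (f c) := by
  induction s using Finset.induction_on with
  | empty => simp
  | insert c s hc ih => rw [Finset.sum_insert hc, Finset.prod_insert hc, AddChar.map_add_eq_mul, ih]

theorem expect_addChar_mul {F : Type*} [Field F] [Fintype F] {θ : AddChar F ℂ} (hθ : θ ≠ 1)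
    (c : F) : 𝔼 t, θ (c * t) = if c = 0 then 1 else 0 := by
  have h := AddChar.sum_mulShift c (AddChar.IsPrimitive.of_ne_one hθ)
  have hF : (Fintype.card F : ℂ) ≠ 0 := Nat.cast_ne_zero.2 Fintype.card_ne_zero
  rw [Fintype.expect_eq_sum_div_card]
  simp only [mul_comm c, h]
  split_ifs <;> simp [hF]

theorem expect_ite_eq_zero {F : Type*} [Field F] [Fintype F] :
    𝔼 t : F, (if t = 0 then (1 : ℂ) else 0) = (Nat.card F : ℂ)⁻¹ := by
  rw [Fintype.expect_eq_sum_div_card]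
  simp

end Expectation

/-! ### Row and column vectors of an arc -/

/-- The vector with entry `1` at `p` and with the entries of `x` on `S`, and zeros elsewhere. -/
noncomputable def arcVec {n : ℕ} {F : Type*} [Field F] (S : Finset (Fin n)) (p : Fin n)
    (x : Fin n → F) : Fin n → F :=
  fun k => if k = p then 1 else if k ∈ S then x k else 0

/-- The nodes of `L` strictly between `i` and `l`. -/
noncomputable def nodesBetween {n : ℕ} (L : Finset (Fin n)) (i l : Fin n) : Finset (Fin n) :=
  L.filter fun j => i < j ∧ j < l

theorem mem_nodesBetween {n : ℕ} {L : Finset (Fin n)} {i l j : Fin n} :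
    j ∈ nodesBetween L i l ↔ j ∈ L ∧ i < j ∧ j < l := by
  simp [nodesBetween]

section arcVec

variable {n : ℕ} {F : Type*} [Field F]

theorem arcVec_self (S : Finset (Fin n)) (p : Fin n) (x : Fin n → F) : arcVec S p x p = 1 := by
  simp [arcVec]

theorem arcVec_eq_zero {S : Finset (Fin n)} {p k : Fin n} (hk : k ≠ p) (hS : k ∉ S)
    (x : Fin n → F) : arcVec S p x k = 0 := by
  simp [arcVec, hk, hS]

/-- The coordinates average independently: those in `S` give orthogonality, the one at `p` is frozen
at `1`, and the others do not occur. -/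
theorem expect_addChar_arcVec [Fintype F] {θ : AddChar F ℂ} (hθ : θ ≠ 1) {S : Finset (Fin n)}
    {p : Fin n} (hp : p ∉ S) (w : Fin n → F) :
    𝔼 y, θ (∑ k, w k * arcVec S p y k) = if ∀ k ∈ S, w k = 0 then θ (w p) else 0 := by
  have h : ∀ y : Fin n → F, θ (∑ k, w k * arcVec S p y k) =
      ∏ k, (fun k t => θ (w k * if k = p then 1 else if k ∈ S then t else 0)) k (y k) := by
    intro y
    rw [addChar_sum_eq_prod]
    rfl
  have h2 := expect_pi_prod (fun (k : Fin n) (t : F) =>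
    θ (w k * if k = p then 1 else if k ∈ S then t else 0))
  refine (Finset.expect_congr rfl fun y _ => h y).trans (h2.trans ?_)
  have h1 : ∀ k, 𝔼 t : F, θ (w k * if k = p then 1 else if k ∈ S then t else 0) =
      (if k = p then θ (w p) else 1) * if k ∈ S → w k = 0 then 1 else 0 := by
    intro k
    by_cases hk : k = p
    · subst hk
      simp [hp]
    · by_cases hS : k ∈ S
      · simp [hk, hS, expect_addChar_mul hθ]
      · simp [hk, hS]
  simp only [h1, prod_mul_distrib]
  rw [Finset.prod_ite_eq' univ p, if_pos (mem_univ _), Finset.prod_ite_zero]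
  simp

/-- Along the rank `d`, `A` is unitriangular, so `A w` and `w` agree at `j` once `w` vanishes at all
lower ranks. The rank takes values in `ℤ` so that both the order of the nodes and its reverse can be
used. -/
theorem unitriangular_mulVec {S : Finset (Fin n)} {p : Fin n} (d : Fin n → ℤ)
    (hS : ∀ k ∈ S, d k < d p) {A : Matrix (Fin n) (Fin n) F} (hA : ∀ k, A k k = 1)
    (hA' : ∀ j k, j ≠ k → A j k ≠ 0 → d k < d j) {w : Fin n → F}
    (hw : ∀ k, d k < d p → k ∉ S → w k = 0) :
    ((∀ k ∈ S, A.mulVec w k = 0) ↔ ∀ k ∈ S, w k = 0) ∧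
      ((∀ k ∈ S, w k = 0) → A.mulVec w p = w p) := by
  have key : ∀ j, d j ≤ d p → (∀ k ∈ S, d k < d j → w k = 0) → A.mulVec w j = w j := by
    intro j hj h
    rw [Matrix.mulVec, dotProduct, Finset.sum_eq_single j]
    · rw [hA, one_mul]
    · intro k _ hk
      by_cases hz : A j k = 0
      · rw [hz, zero_mul]
      · have hd := hA' j k (Ne.symm hk) hz
        by_cases hkS : k ∈ S
        · rw [h k hkS hd, mul_zero]
        · rw [hw k (lt_of_lt_of_le hd hj) hkS, mul_zero]
    · simp
  refine ⟨⟨fun h => ?_, fun h k hk => ?_⟩, fun h => key p le_rfl fun k hk _ => h k hk⟩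
  · by_contra hne
    push Not at hne
    -- At a node of `S` of least rank with `w k ≠ 0`, `A w` and `w` still agree, a contradiction.
    obtain ⟨k, hk, hmin⟩ := Finset.exists_min_image (S.filter fun k => w k ≠ 0) d
      (by obtain ⟨k, hk, hk'⟩ := hne; exact ⟨k, by simp [hk, hk']⟩)
    rw [Finset.mem_filter] at hk
    refine hk.2 ?_
    rw [← key k (hS k hk.1).le, h k hk.1]
    intro k' hk' hlt
    by_contra hz
    exact absurd (hmin k' (by simp [hk', hz])) (not_le.2 hlt)
  · rw [key k (hS k hk).le fun k' hk' _ => h k' hk', h k hk]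

end arcVec

/-! ### The averaged form of an arc supercharacter and its invariance -/

/-- The matrices which vanish outside of the positions `(j, k)` with `j < k` and `j, k ∈ L`. -/
def IsStrictUpperOn {n : ℕ} {F : Type*} [Field F] (L : Finset (Fin n))
    (N : Matrix (Fin n) (Fin n) F) : Prop :=
  ∀ j k, ¬ (j < k ∧ j ∈ L ∧ k ∈ L) → N j k = 0

theorem IsStrictUpperOn.transpose_mulVec_arcVec {n : ℕ} {F : Type*} [Field F] {L : Finset (Fin n)}
    {N : Matrix (Fin n) (Fin n) F} (hN : IsStrictUpperOn L N) {S : Finset (Fin n)}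
    {p : Fin n} (hS : ∀ j ∈ S, p < j) (x : Fin n → F) {k : Fin n} (hk : k ≤ p ∨ k ∉ L) :
    N.transpose.mulVec (arcVec S p x) k = 0 := by
  rw [Matrix.mulVec, dotProduct]
  refine Finset.sum_eq_zero fun j _ => ?_
  rw [Matrix.transpose_apply]
  by_cases h : p ≤ j
  · rw [hN j k, zero_mul]
    rintro ⟨h1, _, h2⟩
    rcases hk with hk | hk
    · exact absurd (h1.trans_le hk) (not_lt.2 h)
    · exact hk h2
  · rw [arcVec_eq_zero, mul_zero]
    · rintro rfl; exact h le_rfl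
    · intro hj; exact h (hS j hj).le

theorem IsStrictUpperOn.mulVec_arcVec {n : ℕ} {F : Type*} [Field F] {L : Finset (Fin n)}
    {N : Matrix (Fin n) (Fin n) F} (hN : IsStrictUpperOn L N) {S : Finset (Fin n)}
    {p : Fin n} (hS : ∀ j ∈ S, j < p) (y : Fin n → F) {j : Fin n} (hj : p ≤ j ∨ j ∉ L) :
    N.mulVec (arcVec S p y) j = 0 := by
  rw [Matrix.mulVec, dotProduct]
  refine Finset.sum_eq_zero fun k _ => ?_
  by_cases h : k ≤ p
  · rw [hN j k, zero_mul]
    rintro ⟨h1, h2, _⟩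
    rcases hj with hj | hj
    · exact absurd (h1.trans_le h) (not_lt.2 hj)
    · exact hj h2
  · rw [arcVec_eq_zero, mul_zero]
    · rintro rfl; exact h le_rfl
    · intro hj; exact h (hS k hj).le

/-- The supercharacter of an arc `i-l` with label `a` as an average over row and column vectors,
in terms of `N = u - 1`, up to the factor `χ(1)`. -/
noncomputable def arcAverage {n : ℕ} {F : Type*} [Field F] [Fintype F] (θ : AddChar F ℂ)
    (L : Finset (Fin n)) (α : Arc n F) (N : Matrix (Fin n) (Fin n) F) : ℂ :=
  𝔼 x, 𝔼 y, θ (α.label * ∑ j, ∑ k, arcVec (nodesBetween L α.left α.right) α.left x j * N j k *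
    arcVec (nodesBetween L α.left α.right) α.right y k)

section arcAverage

variable {n : ℕ} {F : Type*} [Field F] [Fintype F] {θ : AddChar F ℂ} {L : Finset (Fin n)}
  {α : Arc n F} {N : Matrix (Fin n) (Fin n) F}

theorem arcAverage_eq_expect_row (hθ : θ ≠ 1) (hα : α.label ≠ 0)
    (N : Matrix (Fin n) (Fin n) F) :
    arcAverage θ L α N = 𝔼 x, if ∀ k ∈ nodesBetween L α.left α.right,
        N.transpose.mulVec (arcVec (nodesBetween L α.left α.right) α.left x) k = 0
      then θ (α.label * N.transpose.mulVec
        (arcVec (nodesBetween L α.left α.right) α.left x) α.right) else 0 := by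
  refine Finset.expect_congr rfl fun x _ => ?_
  set X := arcVec (nodesBetween L α.left α.right) α.left x
  have := expect_addChar_arcVec hθ (S := nodesBetween L α.left α.right) (p := α.right)
    (by simp [mem_nodesBetween]) (fun k => α.label * N.transpose.mulVec X k)
  simp only [mul_eq_zero, hα, false_or] at this
  rw [← this]
  refine Finset.expect_congr rfl fun y _ => ?_
  congr 1
  rw [Finset.sum_comm, Finset.mul_sum]
  refine Finset.sum_congr rfl fun k _ => ?_
  rw [Matrix.mulVec, dotProduct, mul_assoc, Finset.sum_mul]
  congr 1
  refine Finset.sum_congr rfl fun j _ => ?_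
  rw [Matrix.transpose_apply, mul_comm (X j)]

theorem arcAverage_eq_expect_col (hθ : θ ≠ 1) (hα : α.label ≠ 0)
    (N : Matrix (Fin n) (Fin n) F) :
    arcAverage θ L α N = 𝔼 y, if ∀ j ∈ nodesBetween L α.left α.right,
        N.mulVec (arcVec (nodesBetween L α.left α.right) α.right y) j = 0
      then θ (α.label * N.mulVec
        (arcVec (nodesBetween L α.left α.right) α.right y) α.left) else 0 := by
  rw [arcAverage, Finset.expect_comm]
  refine Finset.expect_congr rfl fun y _ => ?_
  set Y := arcVec (nodesBetween L α.left α.right) α.right y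
  have := expect_addChar_arcVec hθ (S := nodesBetween L α.left α.right) (p := α.left)
    (by simp [mem_nodesBetween]) (fun k => α.label * N.mulVec Y k)
  simp only [mul_eq_zero, hα, false_or] at this
  rw [← this]
  refine Finset.expect_congr rfl fun x _ => ?_
  congr 1
  rw [Finset.mul_sum]
  refine Finset.sum_congr rfl fun j _ => ?_
  rw [Matrix.mulVec, dotProduct, mul_assoc, Finset.sum_mul]
  congr 1
  refine Finset.sum_congr rfl fun k _ => ?_
  ring

/-- With the column vector averaged out, only `x N` enters, on the nodes between and at the right
endpoint. It vanishes at every other node left of that endpoint, so the unitriangular `h` changes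
neither the vanishing conditions nor, under them, the phase. -/
theorem arcAverage_mul_right (hθ : θ ≠ 1) (hα : α.label ≠ 0) (hN : IsStrictUpperOn L N)
    {h : Matrix (Fin n) (Fin n) F} (hh : IsUnipotentOn L h) :
    arcAverage θ L α (N * h) = arcAverage θ L α N := by
  rw [arcAverage_eq_expect_row hθ hα, arcAverage_eq_expect_row hθ hα]
  refine Finset.expect_congr rfl fun x _ => ?_
  obtain ⟨h1, h2⟩ := unitriangular_mulVec (S := nodesBetween L α.left α.right) (p := α.right)
    (fun k => (k.1 : ℤ)) (fun k hk => by simpa using (mem_nodesBetween.1 hk).2.2)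
    (A := h.transpose) (fun k => hh.1 k)
    (fun j k hjk hne => by
      by_contra hlt
      simp only [Nat.cast_lt, Fin.val_fin_lt, not_lt] at hlt
      exact hne (hh.2.1 k j (lt_of_le_of_ne hlt hjk)))
    (w := N.transpose.mulVec (arcVec (nodesBetween L α.left α.right) α.left x))
    (fun k hk hkS => by
      refine hN.transpose_mulVec_arcVec (fun j hj => (mem_nodesBetween.1 hj).2.1) x ?_
      simp only [Nat.cast_lt, Fin.val_fin_lt] at hk
      by_contra hcon
      push Not at hcon
      exact hkS (mem_nodesBetween.2 ⟨hcon.2, hcon.1, hk⟩))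
  rw [Matrix.mulVec_mulVec, ← Matrix.transpose_mul] at h1 h2
  by_cases hc : ∀ k ∈ nodesBetween L α.left α.right,
      N.transpose.mulVec (arcVec (nodesBetween L α.left α.right) α.left x) k = 0
  · rw [if_pos (h1.2 hc), if_pos hc, h2 hc]
  · rw [if_neg (fun h => hc (h1.1 h)), if_neg hc]

theorem arcAverage_mul_left (hθ : θ ≠ 1) (hα : α.label ≠ 0) (hN : IsStrictUpperOn L N)
    {g : Matrix (Fin n) (Fin n) F} (hg : IsUnipotentOn L g) :
    arcAverage θ L α (g * N) = arcAverage θ L α N := by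
  rw [arcAverage_eq_expect_col hθ hα, arcAverage_eq_expect_col hθ hα]
  refine Finset.expect_congr rfl fun y _ => ?_
  obtain ⟨h1, h2⟩ := unitriangular_mulVec (S := nodesBetween L α.left α.right) (p := α.left)
    (fun k => -(k.1 : ℤ)) (fun k hk => by simpa using (mem_nodesBetween.1 hk).2.1)
    (A := g) (fun k => hg.1 k)
    (fun j k hjk hne => by
      by_contra hlt
      simp only [neg_lt_neg_iff, Nat.cast_lt, Fin.val_fin_lt, not_lt] at hlt
      exact hne (hg.2.1 j k (lt_of_le_of_ne hlt hjk.symm)))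
    (w := N.mulVec (arcVec (nodesBetween L α.left α.right) α.right y))
    (fun k hk hkS => by
      refine hN.mulVec_arcVec (fun j hj => (mem_nodesBetween.1 hj).2.2) y ?_
      simp only [neg_lt_neg_iff, Nat.cast_lt, Fin.val_fin_lt] at hk
      by_contra hcon
      push Not at hcon
      exact hkS (mem_nodesBetween.2 ⟨hcon.2, hk, hcon.1⟩))
  rw [Matrix.mulVec_mulVec] at h1 h2
  by_cases hc : ∀ k ∈ nodesBetween L α.left α.right,
      N.mulVec (arcVec (nodesBetween L α.left α.right) α.right y) k = 0
  · rw [if_pos (h1.2 hc), if_pos hc, h2 hc]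
  · rw [if_neg (fun h => hc (h1.1 h)), if_neg hc]

end arcAverage

/-! ### Evaluation on superclass representatives -/

section Evaluation

variable {n : ℕ} {F : Type*} [Field F] [Fintype F] {θ : AddChar F ℂ} {L : Finset (Fin n)}
  {α : Arc n F} {mu : Finset (Arc n F)}

theorem expect_expect_arc_factor (hθ : θ ≠ 1) {S : Finset (Fin n)} {i l j k : Fin n} {c : F}
    (hc : c ≠ 0) (hS : ∀ m, (m = j ∨ m = k) → (m ∈ S ↔ i < m ∧ m < l)) (hil : i < l)
    (hjk : j < k) :
    𝔼 s : F, 𝔼 t : F, θ (c * ((if j = i then 1 else if j ∈ S then s else 0) *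
        (if k = l then 1 else if k ∈ S then t else 0))) =
      if (i = j ∧ j < k ∧ k < l) ∨ (i < j ∧ j < k ∧ k = l) then 0
      else (if i < j ∧ j < k ∧ k < l then (Nat.card F : ℂ)⁻¹ else 1) *
        (if j = i ∧ k = l then θ c else 1) := by
  have hj := hS j (Or.inl rfl)
  have hk := hS k (Or.inr rfl)
  have hinner : ∀ s : F, 𝔼 t : F, θ (c * (s * t)) = if s = 0 then 1 else 0 := by
    intro s
    simp only [← mul_assoc, expect_addChar_mul hθ, mul_eq_zero, hc, false_or]
  by_cases hji : j = i
  · subst hji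
    by_cases hkl : k = l
    · subst hkl
      simp
    · by_cases hlt : k < l
      · have hkS : k ∈ S := hk.2 ⟨hjk, hlt⟩
        simp [hkl, hkS, hlt, hjk, expect_addChar_mul hθ, hc]
      · have hkS : k ∉ S := fun h => hlt (hk.1 h).2
        simp [hkl, hkS, hlt]
  · by_cases hjS : j ∈ S
    · have hij := (hj.1 hjS).1
      have hij' : i ≠ j := hij.ne
      by_cases hkl : k = l
      · subst hkl
        simp [hji, hjS, hij, hjk, expect_addChar_mul hθ, hc]
      · by_cases hlt : k < l
        · have hkS : k ∈ S := hk.2 ⟨hij.trans hjk, hlt⟩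
          simp only [hji, hjS, hkl, hkS, if_true, if_false, hinner, expect_ite_eq_zero]
          simp [hij, hij', hjk, hlt]
        · have hkS : k ∉ S := fun h => hlt (hk.1 h).2
          simp [hkl, hkS, hlt, hji]
    · have h1 : ¬ (i < j ∧ j < k ∧ k = l) := by
        rintro ⟨h1, h2, rfl⟩; exact hjS (hj.2 ⟨h1, h2⟩)
      have h2 : ¬ (i < j ∧ j < k ∧ k < l) := by
        rintro ⟨h1, h2, h3⟩; exact hjS (hj.2 ⟨h1, h2.trans h3⟩)
      have h3 : ¬ (i = j ∧ j < k ∧ k < l) := fun h => hji h.1.symm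
      rw [if_neg (by tauto), if_neg h2, if_neg (fun h => hji h.1)]
      simp [hji, hjS]

/-- Arcs of `mu` have distinct left and distinct right endpoints, so they read different coordinates
of `x` and of `y`, and the average factors over `mu`. -/
theorem arcAverage_sum_single (hθ : θ ≠ 1) (hα : α.label ≠ 0) (hlr : α.left < α.right)
    (hmu : IsQSetPartition L mu) :
    (Nat.card F : ℂ) ^ (nodesBetween L α.left α.right).card *
      arcAverage θ L α (∑ β ∈ mu, Matrix.single β.left β.right β.label) =
      arcValue θ L α mu := by
  set S := nodesBetween L α.left α.right with hSdef
  let g : Arc n F → F → F → ℂ := fun β s t =>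
    θ (α.label * β.label * ((if β.left = α.left then 1 else if β.left ∈ S then s else 0) *
        (if β.right = α.right then 1 else if β.right ∈ S then t else 0)))
  have hprod : ∀ x y : Fin n → F, θ (α.label * ∑ j, ∑ k, arcVec S α.left x j *
      (∑ β ∈ mu, Matrix.single β.left β.right β.label) j k * arcVec S α.right y k) =
      ∏ β ∈ mu, g β (x β.left) (y β.right) := by
    intro x y
    have h1 : ∑ j, ∑ k, arcVec S α.left x j *
      (∑ β ∈ mu, Matrix.single β.left β.right β.label) j k * arcVec S α.right y k =
        ∑ β ∈ mu, β.label * (arcVec S α.left x β.left * arcVec S α.right y β.right) := by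
      simp only [Matrix.sum_apply, Finset.mul_sum, Finset.sum_mul]
      rw [Finset.sum_congr rfl fun j _ => Finset.sum_comm, Finset.sum_comm]
      refine Finset.sum_congr rfl fun β _ => ?_
      rw [Finset.sum_eq_single β.left, Finset.sum_eq_single β.right]
      · simp; ring
      · intro k _ hk
        simp [hk.symm]
      · simp
      · intro j _ hj
        simp [hj.symm]
      · simp
    rw [h1, Finset.mul_sum, addChar_sum_eq_prod]
    refine Finset.prod_congr rfl fun β _ => ?_
    simp only [g, arcVec, mul_assoc]
  have hleft : Set.InjOn Arc.left (mu : Set (Arc n F)) := fun β hβ γ hγ h => by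
    by_contra hne
    exact (hmu.2 β hβ γ hγ hne).1 h
  have hright : Set.InjOn Arc.right (mu : Set (Arc n F)) := fun β hβ γ hγ h => by
    by_contra hne
    exact (hmu.2 β hβ γ hγ hne).2 h
  have hval : arcAverage θ L α (∑ β ∈ mu, Matrix.single β.left β.right β.label) =
      ∏ β ∈ mu, 𝔼 s, 𝔼 t, g β s t := by
    have hy : ∀ x : Fin n → F, 𝔼 y : Fin n → F, ∏ β ∈ mu, g β (x β.left) (y β.right) =
        ∏ β ∈ mu, 𝔼 t, g β (x β.left) t := fun x =>
      expect_pi_prod_of_injOn mu Arc.right hright fun β t => g β (x β.left) t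
    rw [arcAverage]
    simp only [← hSdef, hprod, hy]
    exact expect_pi_prod_of_injOn mu Arc.left hleft fun β s => 𝔼 t, g β s t
  have hfac : ∀ β ∈ mu, 𝔼 s, 𝔼 t, g β s t =
      if (α.left = β.left ∧ β.left < β.right ∧ β.right < α.right) ∨
        (α.left < β.left ∧ β.left < β.right ∧ β.right = α.right) then 0
      else (if α.left < β.left ∧ β.left < β.right ∧ β.right < α.right
          then (Nat.card F : ℂ)⁻¹ else 1) *
        (if β.left = α.left ∧ β.right = α.right then θ (α.label * β.label) else 1) := by
    intro β hβ
    obtain ⟨h1, h2, h3, h4⟩ := hmu.1 β hβ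
    refine expect_expect_arc_factor hθ (mul_ne_zero hα h4) (fun m hm => ?_) hlr h3
    rw [hSdef, mem_nodesBetween]
    have : m ∈ L := by rcases hm with rfl | rfl <;> assumption
    simp [this]
  rw [hval, arcValue]
  split_ifs with hbad
  · obtain ⟨β, hβ, hb⟩ := hbad
    rw [Finset.prod_eq_zero hβ, mul_zero]
    rw [hfac β hβ, if_pos hb]
  · rw [Finset.prod_congr rfl fun β hβ => (hfac β hβ).trans (if_neg fun h => hbad ⟨β, hβ, h⟩),
      Finset.prod_mul_distrib, ← Finset.prod_filter, ← Finset.prod_filter, Finset.prod_const,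
      ← addChar_sum_eq_prod, ← Finset.mul_sum, ← mul_assoc, inv_pow, ← div_eq_mul_inv]
    rfl

end Evaluation

/-! ### Elimination to a `q`-set partition -/

section Existence

variable {n : ℕ} {F : Type*} [Field F]

theorem IsUnipotentOn.mono {K L : Finset (Fin n)} (hKL : K ⊆ L) {u : Matrix (Fin n) (Fin n) F}
    (hu : IsUnipotentOn K u) : IsUnipotentOn L u :=
  ⟨hu.1, hu.2.1, fun i j hij h => hu.2.2 i j hij fun h' => h ⟨hKL h'.1, hKL h'.2⟩⟩

theorem IsUnipotentOn.sub_one {L : Finset (Fin n)} {u : Matrix (Fin n) (Fin n) F}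
    (hu : IsUnipotentOn L u) : IsStrictUpperOn L (u - 1) := by
  intro j k h
  rw [Matrix.sub_apply]
  rcases lt_trichotomy j k with hjk | rfl | hjk
  · rw [hu.2.2 j k hjk fun h' => h ⟨hjk, h'⟩, Matrix.one_apply_ne hjk.ne, sub_zero]
  · rw [hu.1, Matrix.one_apply_eq, sub_self]
  · rw [hu.2.1 j k hjk, Matrix.one_apply_ne hjk.ne', sub_zero]

theorem IsStrictUpperOn.one_add {L : Finset (Fin n)} {N : Matrix (Fin n) (Fin n) F}
    (hN : IsStrictUpperOn L N) : IsUnipotentOn L (1 + N) := by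
  refine ⟨fun i => ?_, fun i j hij => ?_, fun i j hij h => ?_⟩
  · rw [Matrix.add_apply, hN i i (by simp), Matrix.one_apply_eq, add_zero]
  · rw [Matrix.add_apply, hN i j (fun h => hij.not_gt h.1), Matrix.one_apply_ne hij.ne', add_zero]
  · rw [Matrix.add_apply, hN i j (fun h' => h h'.2), Matrix.one_apply_ne hij.ne, add_zero]

theorem IsUnipotentOn.det_eq_one {L : Finset (Fin n)} {u : Matrix (Fin n) (Fin n) F}
    (hu : IsUnipotentOn L u) : u.det = 1 := by
  rw [Matrix.det_of_isUpperTriangular fun i j hij => hu.2.1 i j hij]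
  simp [hu.1]

theorem IsUnipotentOn.exists_coe_eq [Finite F] {L : Finset (Fin n)}
    {u : Matrix (Fin n) (Fin n) F} (hu : IsUnipotentOn L u) :
    ∃ g : unipotentGroup F L, ((g : GL (Fin n) F) : Matrix (Fin n) (Fin n) F) = u :=
  ⟨⟨Matrix.GeneralLinearGroup.mkOfDetNeZero u (by rw [hu.det_eq_one]; exact one_ne_zero), hu⟩, rfl⟩

/-- Clearing a last column `v` by column operations along `mu` and row operations above the
lowest remaining nonzero entry. -/
theorem exists_isQSetPartition_add_column {L : Finset (Fin n)} {m : Fin n} (hm : ∀ j ∈ L, j < m)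
    {mu : Finset (Arc n F)} (hmu : IsQSetPartition L mu) {v : Fin n → F}
    (hv : ∀ j, j ∉ L → v j = 0) :
    ∃ g h : Matrix (Fin n) (Fin n) F, IsUnipotentOn (insert m L) g ∧
      IsUnipotentOn (insert m L) h ∧ ∃ nu : Finset (Arc n F), IsQSetPartition (insert m L) nu ∧
        g * (∑ β ∈ mu, Matrix.single β.left β.right β.label +
          Matrix.vecMulVec v (Pi.single m 1)) * h =
          ∑ β ∈ nu, Matrix.single β.left β.right β.label := by
  set M : Matrix (Fin n) (Fin n) F := ∑ β ∈ mu, Matrix.single β.left β.right β.label with hM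
  have hmL : m ∉ L := fun h => lt_irrefl _ (hm m h)
  have hmu' : IsQSetPartition (insert m L) mu :=
    ⟨fun β hβ => ⟨mem_insert_of_mem (hmu.1 β hβ).1, mem_insert_of_mem (hmu.1 β hβ).2.1,
      (hmu.1 β hβ).2.2⟩, hmu.2⟩
  -- Subtracting `M c` from the last column clears its entry in each row that holds an arc of `mu`.
  let c : Fin n → F := ∑ β ∈ mu, Pi.single β.right (v β.left / β.label)
  have hc : ∀ k, k ∉ L → c k = 0 := by
    intro k hk
    simp only [c, Finset.sum_apply]
    refine Finset.sum_eq_zero fun β hβ => Pi.single_eq_of_ne ?_ _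
    rintro rfl
    exact hk (hmu.1 β hβ).2.1
  have hcr : ∀ β ∈ mu, c β.right = v β.left / β.label := by
    intro β hβ
    simp only [c, Finset.sum_apply]
    rw [Finset.sum_eq_single β]
    · simp
    · intro γ hγ hne
      exact Pi.single_eq_of_ne (hmu.2 γ hγ β hβ hne).2.symm _
    · exact fun h => absurd hβ h
  have hMc : M.mulVec c = ∑ β ∈ mu, Pi.single β.left (v β.left) := by
    rw [hM, Matrix.sum_mulVec]
    refine Finset.sum_congr rfl fun β hβ => ?_
    have hne := (hmu.1 β hβ).2.2.2
    rw [Matrix.single_mulVec, hcr β hβ, mul_div_cancel₀ _ hne]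
    rfl
  set w : Fin n → F := v - M.mulVec c with hw
  have hwL : ∀ j, j ∉ L → w j = 0 := by
    intro j hj
    rw [hw, hMc, Pi.sub_apply, hv j hj, Finset.sum_apply, zero_sub, neg_eq_zero]
    refine Finset.sum_eq_zero fun β hβ => Pi.single_eq_of_ne ?_ _
    rintro rfl
    exact hj (hmu.1 β hβ).1
  have hwmu : ∀ β ∈ mu, w β.left = 0 := by
    intro β hβ
    rw [hw, hMc, Pi.sub_apply, Finset.sum_apply, Finset.sum_eq_single β]
    · simp
    · intro γ hγ hne
      exact Pi.single_eq_of_ne (hmu.2 γ hγ β hβ hne).1.symm _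
    · exact fun h => absurd hβ h
  have hcol : ∀ d : Fin n → F, (∀ k, k ∉ L → d k = 0) →
      IsStrictUpperOn (insert m L) (Matrix.vecMulVec d (Pi.single m (1 : F))) := by
    intro d hd j k h
    rw [Matrix.vecMulVec_apply]
    by_cases hk : k = m
    · subst hk
      rw [hd j, zero_mul]
      exact fun hj => h ⟨hm j hj, mem_insert_of_mem hj, mem_insert_self _ _⟩
    · rw [Pi.single_eq_of_ne hk, mul_zero]
  have hH : IsUnipotentOn (insert m L) (1 + Matrix.vecMulVec (-c) (Pi.single m (1 : F))) :=
    (hcol (-c) fun k hk => by rw [Pi.neg_apply, hc k hk, neg_zero]).one_add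
  have hmulH : (M + Matrix.vecMulVec v (Pi.single m 1)) *
      (1 + Matrix.vecMulVec (-c) (Pi.single m (1 : F))) =
      M + Matrix.vecMulVec w (Pi.single m 1) := by
    rw [Matrix.mul_add, Matrix.mul_one, Matrix.add_mul, Matrix.mul_vecMulVec,
      Matrix.vecMulVec_mul_vecMulVec, Matrix.mulVec_neg]
    have : (Pi.single m (1 : F) : Fin n → F) ⬝ᵥ (-c) = 0 := by
      simp [hc m hmL]
    rw [this, zero_smul, Matrix.vecMulVec_zero, add_zero, hw, Matrix.sub_vecMulVec,
      Matrix.neg_vecMulVec]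
    abel
  by_cases hw0 : w = 0
  · refine ⟨1, _, IsUnipotentOn.one _, hH, mu, hmu', ?_⟩
    rw [Matrix.one_mul, hmulH, hw0, Matrix.zero_vecMulVec, add_zero]
  -- The lowest nonzero entry is the pivot: clearing the entries above it uses only upper-triangular
  -- row operations.
  obtain ⟨j, hj, hjmax⟩ := Finset.exists_max_image (univ.filter fun j => w j ≠ 0) id (by
    obtain ⟨j, hj⟩ := Function.ne_iff.1 hw0
    exact ⟨j, by simpa using hj⟩)
  simp only [Finset.mem_filter, Finset.mem_univ, true_and, id] at hj hjmax
  have hjL : j ∈ L := by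
    by_contra h
    exact hj (hwL j h)
  let d : Fin n → F := fun k => if k = j then 0 else w k / w j
  have hG : IsUnipotentOn (insert m L) (1 + Matrix.vecMulVec (-d) (Pi.single j (1 : F))) := by
    refine IsStrictUpperOn.one_add fun k l h => ?_
    rw [Matrix.vecMulVec_apply]
    by_cases hl : l = j
    · subst hl
      suffices d k = 0 by rw [Pi.neg_apply, this, neg_zero, zero_mul]
      by_contra hd
      simp only [d] at hd
      split_ifs at hd with hkl
      · exact hd rfl
      · have hwk : w k ≠ 0 := fun h0 => hd (by rw [h0, zero_div])
        refine h ⟨lt_of_le_of_ne (hjmax k hwk) hkl, mem_insert_of_mem ?_, mem_insert_of_mem hjL⟩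
        by_contra hkL
        exact hwk (hwL k hkL)
    · rw [Pi.single_eq_of_ne hl, mul_zero]
  -- The pivot row holds no arc of `mu`, so the row operations leave `M` intact.
  have hrow : Matrix.vecMul (Pi.single j (1 : F)) M = 0 := by
    rw [Matrix.single_one_vecMul]
    funext k
    rw [hM, Matrix.row_apply, Matrix.sum_apply]
    refine Finset.sum_eq_zero fun β hβ => ?_
    rw [Matrix.single_apply, if_neg]
    rintro ⟨rfl, _⟩
    exact hj (hwmu β hβ)
  have hmulG : (1 + Matrix.vecMulVec (-d) (Pi.single j (1 : F))) *
      (M + Matrix.vecMulVec w (Pi.single m 1)) = M + Matrix.single j m (w j) := by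
    rw [Matrix.add_mul, Matrix.one_mul, Matrix.mul_add, Matrix.vecMulVec_mul, hrow,
      Matrix.vecMulVec_zero, zero_add, Matrix.vecMulVec_mul_vecMulVec, single_one_dotProduct,
      add_assoc]
    congr 1
    ext k l
    simp only [Matrix.add_apply, Matrix.vecMulVec_apply, Matrix.single_apply, Pi.neg_apply,
      Pi.smul_apply, smul_eq_mul, d, Pi.single_apply]
    by_cases hl : l = m
    · by_cases hk : k = j
      · simp [hk, hl]
      · simp [hk, hl, Ne.symm hk]
        field_simp
        ring
    · simp [hl, Ne.symm hl]
  have hnew : (⟨j, m, w j⟩ : Arc n F) ∉ mu := fun h => hj (hwmu _ h)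
  refine ⟨_, _, hG, hH, insert ⟨j, m, w j⟩ mu, ⟨?_, ?_⟩, ?_⟩
  · intro β hβ
    rcases Finset.mem_insert.1 hβ with rfl | hβ
    · exact ⟨mem_insert_of_mem hjL, mem_insert_self _ _, hm j hjL, hj⟩
    · exact hmu'.1 β hβ
  · have haux : ∀ β ∈ mu, j ≠ β.left ∧ m ≠ β.right := by
      intro β hβ
      constructor
      · rintro rfl; exact hj (hwmu β hβ)
      · rintro rfl; exact hmL (hmu.1 β hβ).2.1
    intro β hβ γ hγ hne
    rcases Finset.mem_insert.1 hβ with rfl | hβ <;> rcases Finset.mem_insert.1 hγ with rfl | hγ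
    · exact absurd rfl hne
    · exact haux γ hγ
    · exact ⟨(haux β hβ).1.symm, (haux β hβ).2.symm⟩
    · exact hmu.2 β hβ γ hγ hne
  · rw [Matrix.mul_assoc, hmulH, hmulG, Finset.sum_insert hnew, add_comm]

/-- Induction on the largest node `m`: reduce the matrix without column `m`, then clear that column.
The right factor for `L` does not affect column `m`, as its row `m` is a unit vector. -/
theorem IsStrictUpperOn.exists_isQSetPartition {L : Finset (Fin n)}
    {N : Matrix (Fin n) (Fin n) F} (hN : IsStrictUpperOn L N) :
    ∃ g h : Matrix (Fin n) (Fin n) F, IsUnipotentOn L g ∧ IsUnipotentOn L h ∧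
      ∃ mu : Finset (Arc n F), IsQSetPartition L mu ∧
        g * N * h = ∑ β ∈ mu, Matrix.single β.left β.right β.label := by
  induction L using Finset.induction_on_max generalizing N with
  | empty =>
    refine ⟨1, 1, IsUnipotentOn.one _, IsUnipotentOn.one _, ∅, ⟨by simp, by simp⟩, ?_⟩
    have : N = 0 := by
      ext j k
      exact hN j k (by simp)
    simp [this]
  | insert m L hm ih =>
    have hmL : m ∉ L := fun h => lt_irrefl _ (hm m h)
    let N' : Matrix (Fin n) (Fin n) F := Matrix.of fun j k => if k = m then 0 else N j k
    let v : Fin n → F := fun j => N j m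
    have hsplit : N = N' + Matrix.vecMulVec v (Pi.single m 1) := by
      ext j k
      by_cases hk : k = m
      · simp [N', v, Matrix.vecMulVec_apply, hk]
      · simp [N', Matrix.vecMulVec_apply, hk]
    have hN' : IsStrictUpperOn L N' := by
      intro j k h
      simp only [N', Matrix.of_apply]
      split_ifs with hk
      · rfl
      · refine hN j k ?_
        rintro ⟨h1, h2, h3⟩
        have hkL := Finset.mem_of_mem_insert_of_ne h3 hk
        refine h ⟨h1, Finset.mem_of_mem_insert_of_ne h2 ?_, hkL⟩
        exact (h1.trans (hm k hkL)).ne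
    obtain ⟨g, h, hg, hh, mu, hmu, heq⟩ := ih hN'
    have hgv : ∀ j, j ∉ L → g.mulVec v j = 0 := by
      intro j hj
      rw [Matrix.mulVec, dotProduct]
      refine Finset.sum_eq_zero fun k _ => ?_
      rcases lt_trichotomy j k with hjk | rfl | hjk
      · rw [hg.2.2 j k hjk fun h => hj h.1, zero_mul]
      · have : v j = 0 := by
          refine hN j m fun h => hj (Finset.mem_of_mem_insert_of_ne h.2.1 h.1.ne)
        rw [this, mul_zero]
      · rw [hg.2.1 j k hjk, zero_mul]
    have hhm : Matrix.vecMul (Pi.single m (1 : F)) h = Pi.single m 1 := by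
      rw [Matrix.single_one_vecMul]
      funext k
      rw [Matrix.row_apply]
      rcases lt_trichotomy m k with hk | rfl | hk
      · rw [hh.2.2 m k hk fun h => hmL h.1, Pi.single_eq_of_ne hk.ne']
      · rw [hh.1, Pi.single_eq_same]
      · rw [hh.2.1 m k hk, Pi.single_eq_of_ne hk.ne]
    obtain ⟨g', h', hg', hh', nu, hnu, heq'⟩ :=
      exists_isQSetPartition_add_column hm hmu (v := g.mulVec v) hgv
    have hsub : L ⊆ insert m L := Finset.subset_insert m L
    refine ⟨g' * g, h * h', hg'.mul (hg.mono hsub), (hh.mono hsub).mul hh', nu, hnu, ?_⟩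
    have : g * N * h = ∑ β ∈ mu, Matrix.single β.left β.right β.label +
        Matrix.vecMulVec (g.mulVec v) (Pi.single m 1) := by
      rw [hsplit, Matrix.mul_add, Matrix.add_mul, heq, Matrix.mul_vecMulVec, Matrix.vecMulVec_mul,
        hhm]
    rw [← heq', ← this]
    simp only [Matrix.mul_assoc]

theorem exists_mem_superclass [Finite F] {L : Finset (Fin n)} (u : unipotentGroup F L) :
    ∃ mu : Finset (Arc n F), IsQSetPartition L mu ∧ u ∈ superclass L mu := by
  obtain ⟨g, h, hg, hh, mu, hmu, heq⟩ :=
    (IsUnipotentOn.sub_one (show IsUnipotentOn L _ from u.2)).exists_isQSetPartition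
  obtain ⟨x, rfl⟩ := hg.exists_coe_eq
  obtain ⟨y, rfl⟩ := hh.exists_coe_eq
  exact ⟨mu, hmu, x, y, heq⟩

end Existence

theorem IsStrictUpperOn.mul_left {n : ℕ} {F : Type*} [Field F] {L : Finset (Fin n)}
    {N g : Matrix (Fin n) (Fin n) F} (hN : IsStrictUpperOn L N) (hg : IsUnipotentOn L g) :
    IsStrictUpperOn L (g * N) := by
  have h := (hg.mul hN.one_add).sub_one
  have h' := hg.sub_one
  intro j k hjk
  have := h j k hjk
  rw [Matrix.mul_add, Matrix.mul_one, Matrix.sub_apply, Matrix.add_apply, add_sub_right_comm,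
    ← Matrix.sub_apply, h' j k hjk, zero_add] at this
  exact this

/-- Two-sided invariance carries the average from `u - 1` to whichever representative was chosen, so
uniqueness of the superclass is not needed. -/
theorem arcCharacter_eq {n : ℕ} {F : Type*} [Field F] [Fintype F] {θ : AddChar F ℂ} (hθ : θ ≠ 1)
    {L : Finset (Fin n)} {α : Arc n F} (hα : α.label ≠ 0) (hlr : α.left < α.right)
    (u : unipotentGroup F L) :
    arcCharacter θ L α u = (Nat.card F : ℂ) ^ (nodesBetween L α.left α.right).card *
      arcAverage θ L α (((u : GL (Fin n) F) : Matrix (Fin n) (Fin n) F) - 1) := by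
  have hex := exists_mem_superclass u
  rw [arcCharacter, dif_pos hex]
  obtain ⟨hmu, x, y, hxy⟩ := hex.choose_spec
  have hN := IsUnipotentOn.sub_one (show IsUnipotentOn L _ from u.2)
  rw [← arcAverage_sum_single hθ hα hlr hmu, ← hxy,
    arcAverage_mul_right hθ hα (hN.mul_left x.2) y.2, arcAverage_mul_left hθ hα hN x.2]

/-- A system of linear conditions which is triangular with respect to distinct
leading coordinates has the expected number of solutions. -/
theorem expect_triangular_system {P κ F : Type*} [Field F] [Fintype F] [Fintype P] [DecidableEq P]
    [Fintype κ] {lead : κ → P} (hlead : Function.Injective lead) (d : P → ℕ)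
    (T : κ → (P → F) →ₗ[F] F)
    (hT : ∀ c, ∀ N : P → F, (∀ p, d p < d (lead c) → N p = 0) → T c N = N (lead c)) :
    𝔼 N : P → F, (if ∀ c, T c N = 0 then (1 : ℂ) else 0) =
      (Nat.card F : ℂ)⁻¹ ^ Fintype.card κ := by
  -- Replacing each leading coordinate by its form is a triangular, hence bijective, change of
  -- variables; the forms thus become independent uniform coordinates.
  let E : (P → F) →ₗ[F] (P → F) := LinearMap.pi fun p =>
    if h : ∃ c, lead c = p then T h.choose else LinearMap.proj p
  have hE : ∀ c, ∀ N, E N (lead c) = T c N := by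
    intro c N
    have h : ∃ c', lead c' = lead c := ⟨c, rfl⟩
    simp only [E, LinearMap.pi_apply, dif_pos h]
    rw [hlead h.choose_spec]
  have hinj : Function.Injective E := by
    rw [← LinearMap.ker_eq_bot, LinearMap.ker_eq_bot']
    intro N hN
    have key : ∀ m : ℕ, ∀ p, d p = m → N p = 0 := by
      intro m
      induction m using Nat.strong_induction_on with
      | _ m ih =>
        intro p hp
        by_cases h : ∃ c, lead c = p
        · obtain ⟨c, rfl⟩ := h
          rw [← hT c N fun p' hp' => ih _ (hp ▸ hp') p' rfl, ← hE c, hN, Pi.zero_apply]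
        · have : E N p = N p := by simp only [E, LinearMap.pi_apply, dif_neg h]; rfl
          rw [← this, hN, Pi.zero_apply]
    funext p
    exact key _ p rfl
  have hbij : Function.Bijective E := Finite.injective_iff_bijective.1 hinj
  have hpi := expect_pi_prod_of_injOn (univ : Finset κ) lead hlead.injOn
    fun _ (t : F) => if t = 0 then (1 : ℂ) else 0
  simp only [expect_ite_eq_zero, Finset.prod_const] at hpi
  rw [← Finset.card_univ, ← hpi]
  refine Fintype.expect_bijective E hbij _ _ fun N => ?_
  rw [Finset.prod_ite_zero, Finset.prod_const_one]
  simp only [Finset.mem_univ, true_implies, hE]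

/-! ### Indexing and counting the conditions -/

section ArcNodes

variable {n : ℕ} {F : Type*}

/-- The pairs of an arc of `lam` and a node of `K` strictly between its endpoints. -/
noncomputable def arcNodes (K : Finset (Fin n)) (lam : Finset (Arc n F)) :
    Finset (Arc n F × Fin n) :=
  (lam ×ˢ K).filter fun c => c.1.left < c.2 ∧ c.2 < c.1.right

/-- The pairs in `arcNodes K lam` whose form is implied by the others, one for each crossing. -/
noncomputable def redundantNodes (K : Finset (Fin n)) (lam : Finset (Arc n F)) :
    Finset (Arc n F × Fin n) :=
  (crossings K lam).image fun p => (p.1, p.2.left)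

theorem mem_arcNodes {K : Finset (Fin n)} {lam : Finset (Arc n F)} {c : Arc n F × Fin n} :
    c ∈ arcNodes K lam ↔ c.1 ∈ lam ∧ c.2 ∈ nodesBetween K c.1.left c.1.right := by
  simp [arcNodes, mem_nodesBetween, and_assoc]

theorem mem_redundantNodes {K : Finset (Fin n)} {lam : Finset (Arc n F)} {c : Arc n F × Fin n} :
    c ∈ redundantNodes K lam ↔ c.1 ∈ lam ∧ ∃ β ∈ lam, β.left = c.2 ∧
      (c.1.left < β.left ∧ β.left < c.1.right ∧ c.1.right < β.right) ∧
      c.1.left ∉ K ∧ β.right ∉ K ∧ β.left ∈ K ∧ c.1.right ∈ K := by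
  simp only [redundantNodes, crossings, Finset.mem_image, Finset.mem_filter, Finset.mem_product]
  constructor
  · rintro ⟨⟨α, β⟩, ⟨⟨h1, h2⟩, h3⟩, rfl⟩
    exact ⟨h1, β, h2, rfl, h3⟩
  · rintro ⟨h1, β, h2, h3, h4⟩
    exact ⟨(c.1, β), ⟨⟨h1, h2⟩, h4⟩, Prod.ext rfl h3⟩

theorem redundantNodes_subset (K : Finset (Fin n)) (lam : Finset (Arc n F)) :
    redundantNodes K lam ⊆ arcNodes K lam := by
  intro c hc
  obtain ⟨h1, β, _, h3, h4, h5⟩ := mem_redundantNodes.1 hc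
  rw [mem_arcNodes, mem_nodesBetween, ← h3]
  exact ⟨h1, h5.2.2.1, h4.1, h4.2.1⟩

theorem sum_card_nodesBetween {K L : Finset (Fin n)} {lam : Finset (Arc n F)}
    (hKL : K ⊆ L) :
    ∑ α ∈ lam, (nodesBetween L α.left α.right).card = rStat K L lam + (arcNodes K lam).card := by
  have h1 : (arcNodes K lam).card = ∑ α ∈ lam, (nodesBetween K α.left α.right).card := by
    simp only [arcNodes, nodesBetween, Finset.card_filter, Finset.sum_product]
  have h2 : rStat K L lam =
      ∑ α ∈ lam, (L.filter fun j => α.left < j ∧ j < α.right ∧ j ∉ K).card := by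
    simp only [rStat, Finset.card_filter, Finset.sum_product_right]
  rw [h1, h2, ← Finset.sum_add_distrib]
  refine Finset.sum_congr rfl fun α _ => ?_
  rw [← Finset.card_filter_add_card_filter_not (s := nodesBetween L α.left α.right) (· ∈ K),
    add_comm]
  congr 2
  · ext j; simp only [nodesBetween, Finset.mem_filter]; tauto
  · ext j
    simp only [nodesBetween, Finset.mem_filter]
    exact ⟨fun h => ⟨h.2, h.1.2⟩, fun h => ⟨⟨hKL h.1, h.2⟩, h.1⟩⟩

end ArcNodes

/-! ### Linear conditions on the restricted group -/

section Restriction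

variable {n : ℕ} {F : Type*} [Field F]

/-- The positions above the diagonal with row and column in `K`. -/
abbrev UpperPosition (K : Finset (Fin n)) : Type :=
  {p : Fin n × Fin n // p.1 < p.2 ∧ p.1 ∈ K ∧ p.2 ∈ K}

/-- The matrix with the given entries at the positions above the diagonal in `K`. -/
noncomputable def upperMatrix (K : Finset (Fin n)) :
    (UpperPosition K → F) →ₗ[F] Matrix (Fin n) (Fin n) F where
  toFun N := Matrix.of fun j k => if h : j < k ∧ j ∈ K ∧ k ∈ K then N ⟨(j, k), h⟩ else 0
  map_add' N N' := by
    ext j k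
    simp only [Matrix.add_apply, Matrix.of_apply]
    split_ifs <;> simp
  map_smul' c N := by
    ext j k
    simp only [Matrix.smul_apply, Matrix.of_apply]
    split_ifs <;> simp

theorem upperMatrix_apply (K : Finset (Fin n)) (N : UpperPosition K → F) (j k : Fin n) :
    upperMatrix K N j k = if h : j < k ∧ j ∈ K ∧ k ∈ K then N ⟨(j, k), h⟩ else 0 := rfl

theorem isStrictUpperOn_upperMatrix (K : Finset (Fin n)) (N : UpperPosition K → F) :
    IsStrictUpperOn K (upperMatrix K N) := fun j k h => by
  rw [upperMatrix_apply, dif_neg h]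

theorem characterInner_one_eq_expect [Fintype F] {K : Finset (Fin n)}
    (f : unipotentGroup F K → ℂ) (g : Matrix (Fin n) (Fin n) F → ℂ)
    (hfg : ∀ u, f u = g (((u : GL (Fin n) F) : Matrix (Fin n) (Fin n) F) - 1)) :
    characterInner f 1 = 𝔼 N : UpperPosition K → F, g (upperMatrix K N) := by
  let e : unipotentGroup F K → UpperPosition K → F := fun u p =>
    ((u : GL (Fin n) F) : Matrix (Fin n) (Fin n) F) p.1.1 p.1.2
  have he : ∀ u, upperMatrix K (e u) =
      ((u : GL (Fin n) F) : Matrix (Fin n) (Fin n) F) - 1 := by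
    intro u
    have hu := IsUnipotentOn.sub_one (show IsUnipotentOn K _ from u.2)
    ext j k
    rw [upperMatrix_apply]
    split_ifs with h
    · rw [Matrix.sub_apply, Matrix.one_apply_ne h.1.ne, sub_zero]
    · rw [hu j k h]
  have hbij : Function.Bijective e := by
    constructor
    · intro u v huv
      have := he u
      rw [huv, he v] at this
      exact Subtype.ext (Units.ext (sub_left_injective this.symm))
    · intro N
      obtain ⟨u, hu⟩ := (isStrictUpperOn_upperMatrix K N).one_add.exists_coe_eq
      refine ⟨u, funext fun p => ?_⟩
      simp only [e]
      rw [hu, Matrix.add_apply, Matrix.one_apply_ne p.2.1.ne, zero_add, upperMatrix_apply,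
        dif_pos p.2]
  have : Fintype (unipotentGroup F K) := Fintype.ofFinite _
  rw [← Fintype.expect_bijective e hbij f _ fun u => by rw [he, hfg],
    Fintype.expect_eq_sum_div_card, characterInner, finsum_eq_sum_of_fintype,
    Nat.card_eq_fintype_card, div_eq_inv_mul]
  simp

/-- The linear forms cutting out the support of the supercharacter of an arc with exactly one
endpoint in `K`: row forms if the right endpoint is in `K` and column forms otherwise. -/
noncomputable def arcForm (K L : Finset (Fin n)) (α : Arc n F) (y : Fin n → F)
    (N : Matrix (Fin n) (Fin n) F) : Fin n → F :=
  if α.right ∈ K then N.mulVec (arcVec (nodesBetween L α.left α.right) α.right y)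
  else N.transpose.mulVec (arcVec (nodesBetween L α.left α.right) α.left y)

/-- Rows and columns of `N` outside `K` vanish. This makes the phase at the endpoint outside `K`
trivial, and the conditions at nodes outside `K` automatic. -/
theorem arcAverage_eq_expect_arcForm [Fintype F] {θ : AddChar F ℂ} (hθ : θ ≠ 1)
    {K L : Finset (Fin n)} (hKL : K ⊆ L) {α : Arc n F} (hα : α.label ≠ 0)
    (hone : (α.right ∈ K ∧ α.left ∉ K) ∨ (α.right ∉ K ∧ α.left ∈ K))
    {N : Matrix (Fin n) (Fin n) F} (hN : IsStrictUpperOn K N) :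
    arcAverage θ L α N = 𝔼 y, if ∀ j ∈ nodesBetween K α.left α.right, arcForm K L α y N j = 0
      then 1 else 0 := by
  have hmem : ∀ j, j ∈ nodesBetween K α.left α.right ↔
      j ∈ nodesBetween L α.left α.right ∧ j ∈ K := by
    intro j
    simp only [mem_nodesBetween]
    exact ⟨fun h => ⟨⟨hKL h.1, h.2⟩, h.1⟩, fun h => ⟨h.2, h.1.2⟩⟩
  rcases hone with ⟨hr, hl⟩ | ⟨hr, hl⟩
  · rw [arcAverage_eq_expect_col hθ hα]
    refine Finset.expect_congr rfl fun y _ => ?_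
    have hz : ∀ j, j ∉ K →
        N.mulVec (arcVec (nodesBetween L α.left α.right) α.right y) j = 0 := fun j hj =>
      hN.mulVec_arcVec (fun k hk => (mem_nodesBetween.1 hk).2.2) y (Or.inr hj)
    simp only [arcForm, if_pos hr]
    rw [hz _ hl, mul_zero, AddChar.map_zero_eq_one]
    refine if_congr ⟨fun h j hj => h j ((hmem j).1 hj).1, fun h j hj => ?_⟩ rfl rfl
    by_cases hjK : j ∈ K
    · exact h j ((hmem j).2 ⟨hj, hjK⟩)
    · exact hz j hjK
  · rw [arcAverage_eq_expect_row hθ hα]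
    refine Finset.expect_congr rfl fun y _ => ?_
    have hz : ∀ j, j ∉ K →
        N.transpose.mulVec (arcVec (nodesBetween L α.left α.right) α.left y) j = 0 := fun j hj =>
      hN.transpose_mulVec_arcVec (fun k hk => (mem_nodesBetween.1 hk).2.1) y (Or.inr hj)
    simp only [arcForm, if_neg hr]
    rw [hz _ hr, mul_zero, AddChar.map_zero_eq_one]
    refine if_congr ⟨fun h j hj => h j ((hmem j).1 hj).1, fun h j hj => ?_⟩ rfl rfl
    by_cases hjK : j ∈ K
    · exact h j ((hmem j).2 ⟨hj, hjK⟩)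
    · exact hz j hjK

theorem card_redundantNodes {K L : Finset (Fin n)} {lam : Finset (Arc n F)}
    (hlam : IsQSetPartition L lam) : (redundantNodes K lam).card = (crossings K lam).card := by
  refine Finset.card_image_of_injOn ?_
  rintro ⟨α, β⟩ h ⟨α', β'⟩ h' heq
  simp only [Prod.mk.injEq] at heq
  simp only [crossings, Finset.coe_filter, Finset.mem_product, Set.mem_ofPred_eq] at h h'
  refine Prod.ext heq.1 ?_
  by_contra hne
  exact (hlam.2 β h.1.2 β' h'.1.2 hne).1 heq.2

theorem card_arcNodes_sdiff_add_card_crossings {K L : Finset (Fin n)}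
    {lam : Finset (Arc n F)} (hlam : IsQSetPartition L lam) :
    (arcNodes K lam \ redundantNodes K lam).card + (crossings K lam).card =
      (arcNodes K lam).card := by
  rw [← card_redundantNodes hlam]
  exact Finset.card_sdiff_add_card_eq_card (redundantNodes_subset K lam)

/-- At a crossing of `α` with `β`, expand `X N Y`. The row conditions of `β`, which are never
redundant, make it zero. The column conditions of `α` at nodes beyond `β.left`, known by downward
induction on the node, reduce it to the entry of `N Y` at `β.left`, the redundant condition. -/
theorem arcForm_eq_zero_of_notMem_redundantNodes {K L : Finset (Fin n)} {lam : Finset (Arc n F)}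
    (z : Arc n F → Fin n → F) {N : Matrix (Fin n) (Fin n) F} (hN : IsStrictUpperOn K N)
    (h : ∀ c ∈ arcNodes K lam \ redundantNodes K lam, arcForm K L c.1 (z c.1) N c.2 = 0) :
    ∀ c ∈ arcNodes K lam, arcForm K L c.1 (z c.1) N c.2 = 0 := by
  rintro ⟨α, j⟩ hc
  simp only
  induction j using WellFoundedGT.induction with
  | ind j ih =>
  by_cases hred : (α, j) ∈ redundantNodes K lam
  swap
  · exact h _ (Finset.mem_sdiff.2 ⟨hc, hred⟩)
  obtain ⟨hα, β, hβ, hj, hcross, -, hβr, hβl, hαr⟩ := mem_redundantNodes.1 hred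
  simp only at hα hj hcross hαr
  subst hj
  set X := arcVec (nodesBetween L β.left β.right) β.left (z β) with hX
  set Y := arcVec (nodesBetween L α.left α.right) α.right (z α) with hY
  have hformα : arcForm K L α (z α) N = N.mulVec Y := by rw [arcForm, if_pos hαr]
  have hformβ : arcForm K L β (z β) N = N.transpose.mulVec X := by rw [arcForm, if_neg hβr]
  have hzero : X ⬝ᵥ N.mulVec Y = 0 := by
    rw [Matrix.dotProduct_mulVec, ← Matrix.mulVec_transpose, dotProduct]
    refine Finset.sum_eq_zero fun k _ => ?_
    by_cases hk : k ≤ β.left ∨ k ∉ K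
    · rw [hN.transpose_mulVec_arcVec (fun i hi => (mem_nodesBetween.1 hi).2.1) _ hk, zero_mul]
    · push Not at hk
      by_cases hk' : k ≤ α.right
      · have hkβ : (β, k) ∈ arcNodes K lam :=
          mem_arcNodes.2 ⟨hβ, mem_nodesBetween.2 ⟨hk.2, hk.1, hk'.trans_lt hcross.2.2⟩⟩
        rw [← hformβ, h _ (Finset.mem_sdiff.2 ⟨hkβ, fun hr => ?_⟩), zero_mul]
        obtain ⟨_, _, _, _, _, _, _, _, h9⟩ := mem_redundantNodes.1 hr
        exact hβr h9
      · rw [hY, arcVec_eq_zero (fun h => hk' h.le) (fun h => hk' (mem_nodesBetween.1 h).2.2.le),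
          mul_zero]
  rw [dotProduct, Finset.sum_eq_single β.left] at hzero
  · rwa [hX, arcVec_self, one_mul, ← hformα] at hzero
  · intro k _ hk
    by_cases hkr : α.right ≤ k ∨ k ∉ K
    · rw [hN.mulVec_arcVec (fun i hi => (mem_nodesBetween.1 hi).2.2) _ hkr, mul_zero]
    · push Not at hkr
      by_cases hlt : β.left < k
      · rw [← hformα, ih k hlt
          (mem_arcNodes.2 ⟨hα, mem_nodesBetween.2 ⟨hkr.2, hcross.1.trans hlt, hkr.1⟩⟩), mul_zero]
      · rw [hX, arcVec_eq_zero hk (fun h => hlt (mem_nodesBetween.1 h).2.1), zero_mul]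
  · simp

end Restriction

/-! ### Independence of the remaining conditions and the multiplicity -/

section Multiplicity

variable {n : ℕ} {F : Type*} [Field F] [Fintype F] {K L : Finset (Fin n)}
  {lam : Finset (Arc n F)}

/-- The nonredundant conditions are triangular for the distance from the diagonal, so the
probability does not depend on `z`. -/
theorem expect_prod_arcForm (hlam : IsQSetPartition L lam)
    (hone : ∀ α ∈ lam, (α.right ∈ K ∧ α.left ∉ K) ∨ (α.right ∉ K ∧ α.left ∈ K))
    (z : Arc n F → Fin n → F) :
    𝔼 N : UpperPosition K → F, ∏ α ∈ lam, (if ∀ j ∈ nodesBetween K α.left α.right,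
        arcForm K L α (z α) (upperMatrix K N) j = 0 then (1 : ℂ) else 0) =
      (Nat.card F : ℂ)⁻¹ ^ (arcNodes K lam \ redundantNodes K lam).card := by
  set I := arcNodes K lam \ redundantNodes K lam with hI
  have hmem : ∀ c : I, c.1.1 ∈ lam ∧ c.1.2 ∈ K ∧ c.1.1.left < c.1.2 ∧ c.1.2 < c.1.1.right := by
    intro c
    have := mem_arcNodes.1 (Finset.mem_sdiff.1 c.2).1
    rwa [mem_nodesBetween] at this
  let T : I → (UpperPosition K → F) →ₗ[F] F := fun c =>
    { toFun := fun N => arcForm K L c.1.1 (z c.1.1) (upperMatrix K N) c.1.2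
      map_add' := fun N N' => by
        rw [map_add]
        unfold arcForm
        split_ifs <;> simp [Matrix.add_mulVec]
      map_smul' := fun a N => by
        rw [map_smul]
        unfold arcForm
        split_ifs <;> simp [Matrix.smul_mulVec] }
  let lead : I → UpperPosition K := fun c =>
    if h : c.1.1.right ∈ K then ⟨(c.1.2, c.1.1.right), (hmem c).2.2.2, (hmem c).2.1, h⟩
    else ⟨(c.1.1.left, c.1.2), (hmem c).2.2.1,
      ((hone _ (hmem c).1).resolve_left fun h' => h h'.1).2, (hmem c).2.1⟩
  have hlead_right : ∀ c : I, c.1.1.right ∈ K → (lead c).1 = (c.1.2, c.1.1.right) :=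
    fun c h => by simp only [lead, dif_pos h]
  have hlead_left : ∀ c : I, c.1.1.right ∉ K → (lead c).1 = (c.1.1.left, c.1.2) :=
    fun c h => by simp only [lead, dif_neg h]
  -- A row and a column condition with the same leading position form a crossing, which would make
  -- the column condition redundant.
  have hmixed : ∀ c c' : I, c.1.1.right ∈ K → c'.1.1.right ∉ K → lead c ≠ lead c' := by
    intro c c' h h' heq
    have heq' := congrArg Subtype.val heq
    rw [hlead_right c h, hlead_left c' h', Prod.mk.injEq] at heq'
    obtain ⟨h1, h2⟩ := heq'
    have hc := hmem c
    have hc' := hmem c'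
    refine (Finset.mem_sdiff.1 c.2).2 (mem_redundantNodes.2
      ⟨hc.1, c'.1.1, hc'.1, h1.symm, ⟨?_, ?_, ?_⟩, ?_, h', ?_, h⟩)
    · exact h1 ▸ hc.2.2.1
    · exact h1 ▸ hc.2.2.2
    · exact h2 ▸ hc'.2.2.2
    · exact ((hone _ hc.1).resolve_right fun h'' => h''.1 h).2
    · exact h1 ▸ hc.2.1
  have hlead : Function.Injective lead := by
    intro c c' heq
    have heq' := congrArg Subtype.val heq
    by_cases h : c.1.1.right ∈ K <;> by_cases h' : c'.1.1.right ∈ K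
    · rw [hlead_right c h, hlead_right c' h', Prod.mk.injEq] at heq'
      refine Subtype.ext (Prod.ext ?_ heq'.1)
      by_contra hne
      exact (hlam.2 _ (hmem c).1 _ (hmem c').1 hne).2 heq'.2
    · exact absurd heq (hmixed c c' h h')
    · exact absurd heq.symm (hmixed c' c h' h)
    · rw [hlead_left c h, hlead_left c' h', Prod.mk.injEq] at heq'
      refine Subtype.ext (Prod.ext ?_ heq'.2)
      by_contra hne
      exact (hlam.2 _ (hmem c).1 _ (hmem c').1 hne).1 heq'.1
  have hT : ∀ c, ∀ N : UpperPosition K → F,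
      (∀ p, p.1.2.1 - p.1.1.1 < (lead c).1.2.1 - (lead c).1.1.1 → N p = 0) →
        T c N = N (lead c) := by
    intro c N hN
    have hval : upperMatrix K N (lead c).1.1 (lead c).1.2 = N (lead c) := by
      rw [upperMatrix_apply, dif_pos (lead c).2]
    have hN' : ∀ j k : Fin n, k.1 - j.1 < (lead c).1.2.1 - (lead c).1.1.1 →
        upperMatrix K N j k = 0 := by
      intro j k hlt
      rw [upperMatrix_apply]
      split_ifs with h
      · exact hN ⟨(j, k), h⟩ hlt
      · rfl
    have hc := hmem c
    rw [← hval]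
    by_cases h : c.1.1.right ∈ K
    · rw [hlead_right c h] at hN' ⊢
      simp only [T, LinearMap.coe_mk, AddHom.coe_mk, arcForm, if_pos h, Matrix.mulVec, dotProduct]
      rw [Finset.sum_eq_single c.1.1.right, arcVec_self, mul_one]
      · intro k _ hk
        by_cases hkS : k ∈ nodesBetween L c.1.1.left c.1.1.right
        · have h1 := (mem_nodesBetween.1 hkS).2.2
          have h2 := hc.2.2.2
          rw [hN' _ k (by simp only; omega), zero_mul]
        · rw [arcVec_eq_zero hk hkS, mul_zero]
      · simp
    · rw [hlead_left c h] at hN' ⊢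
      simp only [T, LinearMap.coe_mk, AddHom.coe_mk, arcForm, if_neg h, Matrix.mulVec, dotProduct,
        Matrix.transpose_apply]
      rw [Finset.sum_eq_single c.1.1.left, arcVec_self, mul_one]
      · intro k _ hk
        by_cases hkS : k ∈ nodesBetween L c.1.1.left c.1.1.right
        · have h1 := (mem_nodesBetween.1 hkS).2.1
          have h2 := hc.2.2.1
          rw [hN' k _ (by simp only; omega), zero_mul]
        · rw [arcVec_eq_zero hk hkS, mul_zero]
      · simp
  rw [← Fintype.card_coe I, ← expect_triangular_system hlead (fun p => p.1.2.1 - p.1.1.1) T hT]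
  refine Finset.expect_congr rfl fun N _ => ?_
  rw [Finset.prod_ite_zero, Finset.prod_const_one]
  refine if_congr ⟨fun h c => h c.1.1 (hmem c).1 c.1.2 (mem_nodesBetween.2 (hmem c).2),
    fun h α hα j hj => ?_⟩ rfl rfl
  exact arcForm_eq_zero_of_notMem_redundantNodes z (isStrictUpperOn_upperMatrix K N)
    (fun c hc => h ⟨c, hc⟩) (α, j) (mem_arcNodes.2 ⟨hα, hj⟩)

theorem prod_expect_eq_expect {κ X : Type*} [Fintype X] [Nonempty X] (s : Finset κ)
    (G : κ → X → ℂ) (x₀ : X) : ∏ c ∈ s, 𝔼 t, G c t =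
      𝔼 z : s → X, ∏ c ∈ s, G c (if h : c ∈ s then z ⟨c, h⟩ else x₀) := by
  rw [← Finset.prod_coe_sort]
  refine (expect_pi_prod fun c : s => G c.1).symm.trans
    (Finset.expect_congr rfl fun z _ => ?_)
  rw [← Finset.prod_coe_sort s]
  refine Finset.prod_congr rfl fun c _ => ?_
  rw [dif_pos c.2]

end Multiplicity

theorem mem_xor_mem_of_card_inter_eq_one {ι : Type*} [DecidableEq ι] {i l : ι} {K : Finset ι}
    (h : (({i, l} : Finset ι) ∩ K).card = 1) (hil : i ≠ l) :
    (l ∈ K ∧ i ∉ K) ∨ (l ∉ K ∧ i ∈ K) := by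
  by_cases hi : i ∈ K <;> by_cases hl : l ∈ K
  · rw [Finset.inter_eq_left.2 (by simp [Finset.insert_subset_iff, hi, hl]),
      Finset.card_pair hil] at h
    omega
  · exact Or.inr ⟨hl, hi⟩
  · exact Or.inl ⟨hl, hi⟩
  · simp [Finset.insert_inter_of_notMem hi, Finset.singleton_inter_of_notMem hl] at h

theorem theorem5p1 {n : ℕ} {F : Type*} [Field F] [Finite F]
    (θ : AddChar F ℂ) (hθ : θ ≠ 1)
    (K L : Finset (Fin n)) (hKL : K ⊆ L)
    (lam : Finset (Arc n F)) (hlam : IsQSetPartition L lam)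
    (hone : ∀ α ∈ lam, (({α.left, α.right} : Finset (Fin n)) ∩ K).card = 1) :
    characterInner (resUnipotent hKL (supercharacter θ L lam)) 1 =
      (Nat.card F : ℂ) ^ rStat K L lam * (Nat.card F : ℂ) ^ (crossings K lam).card := by
  have := Fintype.ofFinite F
  have hone' : ∀ α ∈ lam, (α.right ∈ K ∧ α.left ∉ K) ∨ (α.right ∉ K ∧ α.left ∈ K) :=
    fun α hα => mem_xor_mem_of_card_inter_eq_one (hone α hα) (hlam.1 α hα).2.2.1.ne
  have hq : (Nat.card F : ℂ) ≠ 0 := Nat.cast_ne_zero.2 Nat.card_pos.ne'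
  rw [characterInner_one_eq_expect (resUnipotent hKL (supercharacter θ L lam)) (fun N => ∏ α ∈ lam,
    ((Nat.card F : ℂ) ^ (nodesBetween L α.left α.right).card * arcAverage θ L α N)) fun u =>
      Finset.prod_congr rfl fun α hα =>
        arcCharacter_eq hθ (hlam.1 α hα).2.2.2 (hlam.1 α hα).2.2.1 _]
  have hprod : ∀ N : UpperPosition K → F, ∏ α ∈ lam,
      ((Nat.card F : ℂ) ^ (nodesBetween L α.left α.right).card *
        arcAverage θ L α (upperMatrix K N)) =
      (Nat.card F : ℂ) ^ (rStat K L lam + (arcNodes K lam).card) *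
        𝔼 z : lam → Fin n → F, ∏ α ∈ lam, (if ∀ j ∈ nodesBetween K α.left α.right,
          arcForm K L α (if h : α ∈ lam then z ⟨α, h⟩ else 0) (upperMatrix K N) j = 0
            then (1 : ℂ) else 0) := by
    intro N
    rw [Finset.prod_mul_distrib, Finset.prod_pow_eq_pow_sum, sum_card_nodesBetween hKL,
      Finset.prod_congr rfl fun α hα => arcAverage_eq_expect_arcForm hθ hKL
        (hlam.1 α hα).2.2.2 (hone' α hα) (isStrictUpperOn_upperMatrix K N)]
    congr 1
    exact prod_expect_eq_expect lam (fun α y => if ∀ j ∈ nodesBetween K α.left α.right,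
      arcForm K L α y (upperMatrix K N) j = 0 then (1 : ℂ) else 0) 0
  simp only [hprod]
  -- With the averages exchanged, the inner one over `N` is the same for every choice of vectors, so
  -- the outer one averages a constant.
  rw [← Finset.mul_expect, Finset.expect_comm,
    Finset.expect_congr rfl fun z _ => expect_prod_arcForm hlam hone' _, Fintype.expect_const,
    ← card_arcNodes_sdiff_add_card_crossings hlam, pow_add, pow_add, inv_pow]
  field_simp
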